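/- Let $\mathfrak g$ be a finite-dimensional complex quadratic Lie algebra, i.e. a complex Lie algebra with a nondegenerate symmetric bilinear form $B$ such that $B([X,Y],Z)=-B(Y,[X,Z])$ for all $X,Y,Z\in\mathfrak g$. For $k\ge 0$ let $\mathcal M_a^k(\mathfrak g)$ be the space of skew symmetric $k$-linear maps $\mathfrak g^k\to\mathfrak g$ (with $\mathcal M_a^0(\mathfrak g)=\mathfrak g$), and let $d:\mathcal M_a^k(\mathfrak g)\to\mathcal M_a^{k+1}(\mathfrak g)$ be the Chevalley--Eilenberg differential with coefficients in the adjoint representation, $$dC(X_1,\dots,X_{k+1})=\sum_i(-1)^{i+1}[X_i,C(\dots,\hat X_i,\dots)]+\sum_{i<j}(-1)^{i+j}C([X_i,X_j],\dots,\hat X_i,\dots,\hat X_j,\dots).$$ For $C\in\mathcal M_a^k(\mathfrak g)$ put $\hat C(Y_1,\dots,Y_{k+1})=B(C(Y_1,\dots,Y_k),Y_{k+1})$; $C$ is called cyclic if $\hat C(Y_1,\dots,Y_{k+1})=(-1)^k\hat C(Y_{k+1},Y_1,\dots,Y_k)$ for all $Y_1,\dots,Y_{k+1}$. Let $\mathcal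 C_c^k(\mathfrak g)$ be the space of cyclic $k$-cochains, $\mathcal C_c(\mathfrak g)=\bigoplus_k\mathcal C_c^k(\mathfrak g)$, and let $H_c^*(\mathfrak g)=\bigoplus_k H_c^k(\mathfrak g)$ be the cohomology of the complex $(\mathcal C_c(\mathfrak g),d)$. A cochain $C$ is invariant if $[X,C(Y_1,\dots,Y_k)]=\sum_i C(Y_1,\dots,[X,Y_i],\dots,Y_k)$ for all $X,Y_1,\dots,Y_k\in\mathfrak g$; let $\mathcal C_c(\mathfrak g)^{\mathfrak g}$ be the space of invariant cyclic cochains. Then every invariant cyclic cochain is a cocycle. If moreover $\mathfrak g$ is reductive (its radical is its center), then every cyclic cohomology class contains one and only one invariant cyclic cocycle; in particular the only invariant cyclic coboundary is $0$, and sending an invariant cyclic cochain to its class is an isomorphism of graded vector spaces $\mathcal C_c(\mathfrak g)^{\mathfrak g}\cong H_c^*(\mathfrak g)$. -/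

import Mathlib

open scoped DirectSum

noncomputable section

namespace CyclicLie

variable {g : Type*} [LieRing g] [LieAlgebra ℂ g]

/-- The space of `k`-cochains of `g` with values in `g`: the skew symmetric `k`-linear maps
`g ^ k → g` (for `k = 0`, this is `g` itself). -/
abbrev Cochain (g : Type*) [LieRing g] [LieAlgebra ℂ g] (k : ℕ) : Type _ :=
  g [⋀^Fin k]→ₗ[ℂ] g

/-! ### The adjoint cohomology complex -/

/-- The linear map `X ↦ ad X ∘ C`, for a `k`-cochain `C`. -/
def adComp {k : ℕ} (C : Cochain g k) : g →ₗ[ℂ] Cochain g k where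
  toFun X := (LieAlgebra.ad ℂ g X).compAlternatingMap C
  map_add' X Y := by ext v; simp
  map_smul' c X := by ext v; simp

/-- The part `∑ i, (-1) ^ i [X i, C (…, X̂ i, …)]` (indices starting at `0`) of the differential. -/
def dAction (k : ℕ) : Cochain g k →ₗ[ℂ] Cochain g (k + 1) where
  toFun C := AlternatingMap.alternatizeUncurryFin (adComp C)
  map_add' C D := by
    rw [← AlternatingMap.alternatizeUncurryFin_add]
    congr 1
    ext X v
    simp [adComp]
  map_smul' c C := by
    rw [RingHom.id_apply, ← AlternatingMap.alternatizeUncurryFin_smul]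
    congr 1
    ext X v
    simp [adComp]

/-- The bilinear map `(X, Y) ↦ C ([X, Y], ⬝, …, ⬝)`, for a `(k + 1)`-cochain `C`. -/
def bracketComp {k : ℕ} (C : Cochain g (k + 1)) : g →ₗ[ℂ] g →ₗ[ℂ] Cochain g k :=
  LinearMap.mk₂ ℂ (fun X Y => C.curryLeft ⁅X, Y⁆)
    (fun X X' Y => by rw [add_lie, map_add]) (fun c X Y => by rw [smul_lie, map_smul])
    (fun X Y Y' => by rw [lie_add, map_add]) (fun c X Y => by rw [lie_smul, map_smul])

/-- The part `∑ i < j, (-1) ^ (i + j) C ([X i, X j], …, X̂ i, …, X̂ j, …)` of the differential,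
written as minus one half of a complete alternating sum; the lemma `dBracket_apply` below gives
the formula without repetitions. -/
def dBracket (k : ℕ) : Cochain g (k + 1) →ₗ[ℂ] Cochain g (k + 2) where
  toFun C := -(1 / 2 : ℂ) • AlternatingMap.alternatizeUncurryFin
    (AlternatingMap.alternatizeUncurryFinLM ∘ₗ bracketComp C)
  map_add' C D := by
    have h : bracketComp (C + D) = bracketComp C + bracketComp D := rfl
    rw [h, LinearMap.comp_add, AlternatingMap.alternatizeUncurryFin_add, smul_add]
  map_smul' c C := by
    have h : bracketComp (c • C) = c • bracketComp C := rfl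
    rw [h, LinearMap.comp_smul, AlternatingMap.alternatizeUncurryFin_smul, smul_comm,
      RingHom.id_apply]

/-- The differential of the adjoint cohomology complex of `g`, that is, the Chevalley–Eilenberg
differential with coefficients in the adjoint representation; see `d_zero_apply` and
`d_succ_apply` for the usual formula. -/
def d : (k : ℕ) → Cochain g k →ₗ[ℂ] Cochain g (k + 1)
  | 0 => dAction 0
  | k + 1 => dAction (k + 1) + dBracket k

theorem dAction_apply {k : ℕ} (C : Cochain g k) (X : Fin (k + 1) → g) :
    dAction k C X = ∑ i : Fin (k + 1), (-1 : ℤ) ^ (i : ℕ) • ⁅X i, C (i.removeNth X)⁆ := by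
  simp [dAction, AlternatingMap.alternatizeUncurryFin_apply, adComp]

/-- The pairs of positions `a < b` are encoded as `(i.castSucc, j.succ)` with `i ≤ j`, whence the
shift by one in the exponent. -/
theorem dBracket_apply {k : ℕ} (C : Cochain g (k + 1)) (X : Fin (k + 2) → g) :
    dBracket k C X = ∑ i : Fin (k + 1), ∑ j ≥ i, (-1 : ℤ) ^ (i + j + 1 : ℕ) •
      C (Fin.cons ⁅X i.castSucc, X j.succ⁆ (j.removeNth (i.castSucc.removeNth X))) := by
  have key : ∀ (a b : g) (w : Fin k → g), C (Fin.cons ⁅b, a⁆ w) = -C (Fin.cons ⁅a, b⁆ w) := by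
    intro a b w
    have h := map_neg C.curryLeft ⁅a, b⁆
    rw [lie_skew] at h
    exact congrArg (fun F : Cochain g k => F w) h
  have h := AlternatingMap.alternatizeUncurryFin_alternatizeUncurryFinLM_comp_apply
    (bracketComp C) X
  have h0 : dBracket k C X = -(1 / 2 : ℂ) • AlternatingMap.alternatizeUncurryFin
      (AlternatingMap.alternatizeUncurryFinLM ∘ₗ bracketComp C) X := rfl
  rw [h0, h, Finset.smul_sum]
  refine Finset.sum_congr rfl fun i _ => ?_
  rw [Finset.smul_sum]
  refine Finset.sum_congr rfl fun j _ => ?_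
  have h1 : ∀ (a b : g) (w : Fin k → g), bracketComp C a b w = C (Fin.cons ⁅a, b⁆ w) :=
    fun _ _ _ => rfl
  rw [h1, h1, key (X i.castSucc), sub_neg_eq_add, ← two_smul ℂ, smul_comm _ (2 : ℂ), smul_smul,
    pow_succ, mul_neg_one, neg_smul]
  norm_num

theorem d_zero_apply (C : Cochain g 0) (X : Fin 1 → g) : d 0 C X = ⁅X 0, C Fin.elim0⁆ := by
  change dAction 0 C X = _
  rw [dAction_apply]
  rw [Fin.sum_univ_one, Fin.val_zero, pow_zero, one_smul]
  congr 2
  exact Subsingleton.elim _ _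

theorem d_succ_apply {k : ℕ} (C : Cochain g (k + 1)) (X : Fin (k + 2) → g) :
    d (k + 1) C X =
      ∑ i : Fin (k + 2), (-1 : ℤ) ^ (i : ℕ) • ⁅X i, C (i.removeNth X)⁆ +
      ∑ i : Fin (k + 1), ∑ j ≥ i, (-1 : ℤ) ^ (i + j + 1 : ℕ) •
        C (Fin.cons ⁅X i.castSucc, X j.succ⁆ (j.removeNth (i.castSucc.removeNth X))) := by
  rw [← dAction_apply, ← dBracket_apply]
  rfl

/-! ### Cyclic cochains and cyclic cohomology -/

/-- `hat B C (Y₁, …, Yₖ₊₁) = B (C (Y₁, …, Yₖ), Yₖ₊₁)`. -/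
def hat (B : LinearMap.BilinForm ℂ g) {k : ℕ} (C : Cochain g k) (Y : Fin (k + 1) → g) : ℂ :=
  B (C (Fin.init Y)) (Y (Fin.last k))

/-- The cyclic `k`-cochains: those with
`hat B C (Y₁, …, Yₖ₊₁) = (-1) ^ k * hat B C (Yₖ₊₁, Y₁, …, Yₖ)`. -/
def cyclicCochains (B : LinearMap.BilinForm ℂ g) (k : ℕ) : Submodule ℂ (Cochain g k) where
  carrier := {C | ∀ Y : Fin (k + 1) → g,
    hat B C Y = (-1) ^ k * hat B C (Fin.cons (Y (Fin.last k)) (Fin.init Y) : Fin (k + 1) → g)}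
  add_mem' {C D} hC hD Y := by
    have h1 := hC Y
    have h2 := hD Y
    simp only [hat, AlternatingMap.add_apply, map_add, LinearMap.add_apply] at h1 h2 ⊢
    rw [h1, h2, mul_add]
  zero_mem' Y := by simp [hat]
  smul_mem' c C hC Y := by
    have h1 := hC Y
    simp only [hat, AlternatingMap.smul_apply, map_smul, LinearMap.smul_apply, smul_eq_mul]
      at h1 ⊢
    rw [h1, mul_left_comm]

/-- The cyclic cocycles of degree `k`. -/
def cyclicCocycles (B : LinearMap.BilinForm ℂ g) (k : ℕ) : Submodule ℂ (Cochain g k) :=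
  cyclicCochains B k ⊓ LinearMap.ker (d k)

/-- The cyclic coboundaries of degree `k`: the differentials of cyclic cochains of
degree `k - 1`. -/
def cyclicCoboundaries (B : LinearMap.BilinForm ℂ g) : (k : ℕ) → Submodule ℂ (Cochain g k)
  | 0 => ⊥
  | k + 1 => (cyclicCochains B k).map (d k)

/-- The cyclic cohomology of degree `k`, cyclic cocycles modulo cyclic coboundaries. For an
invariant symmetric form `B`, cyclic coboundaries are cyclic cocycles (`d` preserves cyclic cochains
and squares to zero), so `submoduleOf` only regards them as a subspace of the cocycles. -/
abbrev CyclicCohomology (B : LinearMap.BilinForm ℂ g) (k : ℕ) : Type _ :=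
  cyclicCocycles B k ⧸ (cyclicCoboundaries B k).submoduleOf (cyclicCocycles B k)

/-- The cyclic cohomology class of a cyclic cocycle. -/
def cyclicClass (B : LinearMap.BilinForm ℂ g) (k : ℕ) :
    cyclicCocycles B k →ₗ[ℂ] CyclicCohomology B k :=
  ((cyclicCoboundaries B k).submoduleOf (cyclicCocycles B k)).mkQ

/-! ### Invariants -/

/-- The natural action of `X : g` on cochains:
`(L_X C) (Y₁, …, Yₖ) = [X, C (Y₁, …, Yₖ)] - ∑ i, C (Y₁, …, [X, Yᵢ], …, Yₖ)`. -/
def lieDer {k : ℕ} (X : g) (C : Cochain g k) (Y : Fin k → g) : g :=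
  ⁅X, C Y⁆ - ∑ i, C (Function.update Y i ⁅X, Y i⁆)

/-- The `g`-invariant cyclic `k`-cochains: the cyclic cochains killed by the action of `g`. -/
def invariantCyclicCochains (B : LinearMap.BilinForm ℂ g) (k : ℕ) :
    Submodule ℂ (Cochain g k) where
  carrier := {C | C ∈ cyclicCochains B k ∧ ∀ (X : g) (Y : Fin k → g), lieDer X C Y = 0}
  add_mem' {C D} hC hD := by
    refine ⟨add_mem hC.1 hD.1, fun X Y => ?_⟩
    have h1 := hC.2 X Y
    have h2 := hD.2 X Y
    simp only [lieDer, AlternatingMap.add_apply, lie_add, Finset.sum_add_distrib] at h1 h2 ⊢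
    rw [add_sub_add_comm, h1, h2, add_zero]
  zero_mem' := ⟨zero_mem _, fun X Y => by simp [lieDer]⟩
  smul_mem' c C hC := by
    refine ⟨Submodule.smul_mem _ c hC.1, fun X Y => ?_⟩
    have h1 := hC.2 X Y
    simp only [lieDer, AlternatingMap.smul_apply, lie_smul, ← Finset.smul_sum, ← smul_sub]
      at h1 ⊢
    rw [h1, smul_zero]

end CyclicLie

end

/-! Everything rests on the Cartan calculus for contractions `ι_X`, Lie derivatives `L_X` and `d`:
`ι_X d + d ι_X = L_X` and `[L_X, ι_Y] = ι_[X,Y]` (`contract_d_succ`, `contract_lieDerivative`).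

Split `d` into the part with the adjoint action and the part with brackets of arguments. For cyclic
`C`, invariance of `B` makes the first part dual to the action on cochains: `B (dAction C X) Z = ±
hat (L_Z C) X` (`dAction_eq_hat_lie`). So it vanishes when `C` is invariant, by nondegeneracy.
Alternating `X ↦ L_X C` gives `dAction C + 2 dBracket C`, so the second part vanishes too.

If `g` is reductive, its center acts trivially on cochains, which are thus modules over the
semisimple quotient by the center. By a form of Weyl's theorem, every submodule `V` is the direct
sum of its invariants and of `g • V`. For cyclic cocycles, `L_X C = d (ι_X C)` with `ι_X C` again
cyclic, so `g • V` consists of coboundaries: each class has an invariant representative. If `d D` is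
invariant, decompose `D`: its invariant part is closed and the rest lies in `g • V`, so `d D` is
invariant and in the image of the action, hence zero. -/

noncomputable section

namespace CyclicLie

open AlternatingMap

/-! ### Contraction of alternating maps -/

section Contraction

variable {M N : Type*} [AddCommGroup M] [Module ℂ M] [AddCommGroup N] [Module ℂ N]

/-- Contraction of an alternating map with a vector in the first argument. -/
def contract {n : ℕ} (x : M) : M [⋀^Fin (n + 1)]→ₗ[ℂ] N →ₗ[ℂ] M [⋀^Fin n]→ₗ[ℂ] N :=
  (curryLeftLinearMap (R := ℂ) (M := M) (N := N) (n := n)).flip x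

theorem contract_apply {n : ℕ} (x : M) (f : M [⋀^Fin (n + 1)]→ₗ[ℂ] N) (v : Fin n → M) :
    contract x f v = f (Fin.cons x v : Fin (n + 1) → M) := rfl

/-- Reduces an identity of cochains to one in lower degree; it drives the inductions on the degree
that follow. -/
theorem ext_contract {n : ℕ} {f h : M [⋀^Fin (n + 1)]→ₗ[ℂ] N}
    (H : ∀ x, contract x f = contract x h) : f = h := by
  ext v
  have := congrArg (fun F => F (Fin.tail v)) (H (v 0))
  simpa only [contract_apply, Fin.cons_self_tail] using this

theorem contract_contract {n : ℕ} (x y : M) (f : M [⋀^Fin (n + 2)]→ₗ[ℂ] N) :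
    contract x (contract y f) = -contract y (contract x f) := by
  have h : ∀ z, contract z (contract z f) = 0 := fun z => f.curryLeft_same z
  have hadd : ∀ (n : ℕ) (h : M [⋀^Fin (n + 1)]→ₗ[ℂ] N),
      contract (x + y) h = contract x h + contract y h := fun n h => map_add h.curryLeft x y
  have h1 := h (x + y)
  rw [hadd, hadd, map_add, map_add, h, h, zero_add, add_zero] at h1
  exact eq_neg_of_add_eq_zero_left h1

/-- In the alternating sum the term of index `0` is `f x`; in the others `x` stays in the first slot
and the index shift flips the sign. Degree zero, treated next, has only the first term. -/
theorem contract_alternatizeUncurryFin {n : ℕ} (f : M →ₗ[ℂ] M [⋀^Fin (n + 1)]→ₗ[ℂ] N) (x : M) :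
    contract x (alternatizeUncurryFin f) = f x - alternatizeUncurryFin (contract x ∘ₗ f) := by
  ext v
  rw [contract_apply, alternatizeUncurryFin_apply, Fin.sum_univ_succ, AlternatingMap.sub_apply,
    alternatizeUncurryFin_apply, sub_eq_add_neg, ← Finset.sum_neg_distrib]
  congr 1
  · simp
  · refine Finset.sum_congr rfl fun i _ => ?_
    rw [LinearMap.comp_apply, contract_apply, Fin.val_succ, pow_succ, mul_neg_one, neg_smul,
      Fin.cons_succ]
    congr 3
    ext j
    refine Fin.cases ?_ (fun j => ?_) j
    · simp [Fin.removeNth]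
    · simp [Fin.removeNth]

theorem contract_alternatizeUncurryFin_zero (f : M →ₗ[ℂ] M [⋀^Fin 0]→ₗ[ℂ] N) (x : M) :
    contract x (alternatizeUncurryFin f) = f x := by
  ext v
  rw [contract_apply, alternatizeUncurryFin_apply, Fin.sum_univ_one]
  simp only [Fin.val_zero, pow_zero, one_smul, Fin.cons_zero]
  congr 1

end Contraction

/-! ### Lie derivative and Cartan's formula -/

variable {g : Type*} [LieRing g] [LieAlgebra ℂ g]

theorem adComp_apply {k : ℕ} (C : Cochain g k) (X : g) (Y : Fin k → g) :
    adComp C X Y = ⁅X, C Y⁆ := rfl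

theorem bracketComp_apply {k : ℕ} (C : Cochain g (k + 1)) (X Y : g) :
    bracketComp C X Y = contract ⁅X, Y⁆ C := rfl

theorem contract_lie_swap {k : ℕ} (X Y : g) (C : Cochain g (k + 1)) :
    contract ⁅Y, X⁆ C = -contract ⁅X, Y⁆ C := by
  rw [← lie_skew]
  exact map_neg C.curryLeft ⁅X, Y⁆

/-- The action of `g` on cochains, see `lieDerivative_apply`. -/
def lieDerivative : {k : ℕ} → Cochain g k → g →ₗ[ℂ] Cochain g k
  | 0, C => adComp C
  | _ + 1, C => adComp C - alternatizeUncurryFinLM ∘ₗ bracketComp C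

theorem contract_adComp {k : ℕ} (X Y : g) (C : Cochain g (k + 1)) :
    contract Y (adComp C X) = adComp (contract Y C) X := rfl

/-- The relation `[L_X, ι_Y] = ι_[X,Y]`, which determines the action recursively in the degree. -/
theorem contract_lieDerivative {k : ℕ} (X Y : g) (C : Cochain g (k + 1)) :
    contract Y (lieDerivative C X) = lieDerivative (contract Y C) X - contract ⁅X, Y⁆ C := by
  change contract Y (adComp C X - alternatizeUncurryFin (bracketComp C X)) = _
  rw [map_sub, contract_adComp]
  cases k with
  | zero => rw [contract_alternatizeUncurryFin_zero]; rfl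
  | succ k =>
    have h : contract Y ∘ₗ bracketComp C X = -bracketComp (contract Y C) X := by
      ext Z : 1
      exact contract_contract _ _ _
    rw [contract_alternatizeUncurryFin, h, bracketComp_apply]
    change _ = adComp (contract Y C) X - alternatizeUncurryFin (bracketComp (contract Y C) X) - _
    have h2 : alternatizeUncurryFin (-bracketComp (contract Y C) X) =
        -alternatizeUncurryFin (bracketComp (contract Y C) X) :=
      map_neg (alternatizeUncurryFinLM (R := ℂ)) _
    rw [h2]
    abel

theorem lieDerivative_apply {k : ℕ} (X : g) (C : Cochain g k) (Y : Fin k → g) :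
    lieDerivative C X Y = lieDer X C Y := by
  induction k with
  | zero => simp [lieDerivative, lieDer, adComp_apply]
  | succ k ih =>
    obtain ⟨Z, W, rfl⟩ : ∃ (Z : g) (W : Fin k → g), Y = Fin.cons Z W :=
      ⟨Y 0, Fin.tail Y, (Fin.cons_self_tail Y).symm⟩
    have h := congrArg (fun F => F W) (contract_lieDerivative X Z C)
    simp only [contract_apply, AlternatingMap.sub_apply, ih] at h
    rw [h, lieDer, lieDer, Fin.sum_univ_succ]
    simp only [contract_apply, Fin.cons_zero, Fin.cons_succ, Fin.update_cons_zero,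
      ← Fin.cons_update]
    abel

theorem lieDerivative_add {k : ℕ} (C D : Cochain g k) (X : g) :
    lieDerivative (C + D) X = lieDerivative C X + lieDerivative D X := by
  ext Y
  simp only [lieDerivative_apply, lieDer, AlternatingMap.add_apply, lie_add,
    Finset.sum_add_distrib, add_sub_add_comm]

theorem lieDerivative_smul {k : ℕ} (c : ℂ) (C : Cochain g k) (X : g) :
    lieDerivative (c • C) X = c • lieDerivative C X := by
  ext Y
  simp only [lieDerivative_apply, lieDer, AlternatingMap.smul_apply, lie_smul, ← Finset.smul_sum,
    ← smul_sub]

theorem lieDerivative_sub {k : ℕ} (C D : Cochain g k) (X : g) :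
    lieDerivative (C - D) X = lieDerivative C X - lieDerivative D X := by
  have := lieDerivative_add (C - D) D X
  rw [sub_add_cancel] at this
  exact eq_sub_of_add_eq this.symm

theorem lieDerivative_lie {k : ℕ} (C : Cochain g k) (X Y : g) :
    lieDerivative C ⁅X, Y⁆ =
      lieDerivative (lieDerivative C Y) X - lieDerivative (lieDerivative C X) Y := by
  induction k with
  | zero =>
    ext Z
    simp [lieDerivative, adComp_apply]
  | succ k ih =>
    refine ext_contract fun Z => ?_
    simp only [map_sub, contract_lieDerivative, lieDerivative_sub, ih]
    have h : contract ⁅⁅X, Y⁆, Z⁆ C = contract ⁅X, ⁅Y, Z⁆⁆ C - contract ⁅Y, ⁅X, Z⁆⁆ C := by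
      rw [lie_lie]
      exact map_sub C.curryLeft _ _
    rw [h]
    abel

instance {k : ℕ} : LieRingModule g (Cochain g k) where
  bracket X C := lieDerivative C X
  add_lie X Y C := map_add (lieDerivative C) X Y
  lie_add X C D := lieDerivative_add C D X
  leibniz_lie X Y C := by
    change lieDerivative (lieDerivative C Y) X =
      lieDerivative C ⁅X, Y⁆ + lieDerivative (lieDerivative C X) Y
    rw [lieDerivative_lie, sub_add_cancel]

instance {k : ℕ} : LieModule ℂ g (Cochain g k) where
  smul_lie c X C := map_smul (lieDerivative C) c X
  lie_smul c X C := lieDerivative_smul c C X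

theorem lie_cochain_apply {k : ℕ} (X : g) (C : Cochain g k) (Y : Fin k → g) :
    ⁅X, C⁆ Y = lieDer X C Y :=
  lieDerivative_apply X C Y

theorem contract_lie {k : ℕ} (X Y : g) (C : Cochain g (k + 1)) :
    contract Y ⁅X, C⁆ = ⁅X, contract Y C⁆ - contract ⁅X, Y⁆ C :=
  contract_lieDerivative X Y C

theorem contract_dAction {k : ℕ} (X : g) (C : Cochain g (k + 1)) :
    contract X (dAction (k + 1) C) = adComp C X - dAction k (contract X C) :=
  contract_alternatizeUncurryFin _ _

/-- `X` can be either entry of the bracket; by antisymmetry both cases contribute equally, which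
absorbs the `1 / 2` in `dBracket`. In higher degree, `X` may also lie outside the bracket, whence
the recursive term of the next lemma. -/
theorem contract_dBracket_zero (X : g) (C : Cochain g 1) :
    contract X (dBracket 0 C) = -alternatizeUncurryFin (bracketComp C X) := by
  change contract X (-(1 / 2 : ℂ) • alternatizeUncurryFin
    (alternatizeUncurryFinLM ∘ₗ bracketComp C)) = _
  have h : contract X ∘ₗ alternatizeUncurryFinLM ∘ₗ bracketComp C = -bracketComp C X := by
    ext Y : 1
    change contract X (alternatizeUncurryFin (bracketComp C Y)) = -bracketComp C X Y
    rw [contract_alternatizeUncurryFin_zero]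
    exact contract_lie_swap X Y C
  have h2 : alternatizeUncurryFin (-bracketComp C X) =
      -alternatizeUncurryFin (bracketComp C X) :=
    map_neg (alternatizeUncurryFinLM (R := ℂ)) _
  rw [map_smul, contract_alternatizeUncurryFin, h, h2, LinearMap.comp_apply,
    alternatizeUncurryFinLM_apply, sub_neg_eq_add, ← two_smul ℂ, smul_smul]
  norm_num

theorem contract_dBracket_succ {k : ℕ} (X : g) (C : Cochain g (k + 2)) :
    contract X (dBracket (k + 1) C) =
      -alternatizeUncurryFin (bracketComp C X) - dBracket k (contract X C) := by
  change contract X (-(1 / 2 : ℂ) • alternatizeUncurryFin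
    (alternatizeUncurryFinLM ∘ₗ bracketComp C)) = _ - (-(1 / 2 : ℂ) • alternatizeUncurryFin
    (alternatizeUncurryFinLM ∘ₗ bracketComp (contract X C)))
  have h : contract X ∘ₗ alternatizeUncurryFinLM ∘ₗ bracketComp C =
      -bracketComp C X + alternatizeUncurryFinLM ∘ₗ bracketComp (contract X C) := by
    ext Y : 1
    change contract X (alternatizeUncurryFin (bracketComp C Y)) = -bracketComp C X Y +
      alternatizeUncurryFin (bracketComp (contract X C) Y)
    have h3 : contract X ∘ₗ bracketComp C Y = -bracketComp (contract X C) Y := by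
      ext Z : 1
      exact contract_contract _ _ _
    have h4 : alternatizeUncurryFin (-bracketComp (contract X C) Y) =
        -alternatizeUncurryFin (bracketComp (contract X C) Y) :=
      map_neg (alternatizeUncurryFinLM (R := ℂ)) _
    rw [contract_alternatizeUncurryFin, h3, h4, sub_neg_eq_add]
    congr 1
    exact contract_lie_swap X Y C
  have h2 : alternatizeUncurryFin (-bracketComp C X) =
      -alternatizeUncurryFin (bracketComp C X) :=
    map_neg (alternatizeUncurryFinLM (R := ℂ)) _
  rw [map_smul, contract_alternatizeUncurryFin, h, alternatizeUncurryFin_add, h2,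
    LinearMap.comp_apply, alternatizeUncurryFinLM_apply]
  module

/-- Cartan's formula in degree zero. -/
theorem contract_d_zero (X : g) (C : Cochain g 0) : contract X (d 0 C) = ⁅X, C⁆ :=
  contract_alternatizeUncurryFin_zero _ _

/-- Cartan's formula. -/
theorem contract_d_succ {k : ℕ} (X : g) (C : Cochain g (k + 1)) :
    contract X (d (k + 1) C) = ⁅X, C⁆ - d k (contract X C) := by
  change contract X (dAction (k + 1) C + dBracket k C) =
    adComp C X - alternatizeUncurryFin (bracketComp C X) - _
  rw [map_add, contract_dAction]
  cases k with
  | zero => rw [contract_dBracket_zero]; change _ = _ - dAction 0 _; abel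
  | succ k =>
    rw [contract_dBracket_succ]
    change _ = _ - (dAction _ _ + dBracket _ _)
    abel

/-- Induction on the degree through Cartan's formula and `[L_X, ι_Y] = ι_[X,Y]`, avoiding `d ∘ d =
0`. -/
theorem d_lie {k : ℕ} (X : g) (C : Cochain g k) : d k ⁅X, C⁆ = ⁅X, d k C⁆ := by
  induction k with
  | zero =>
    refine ext_contract fun Y => ?_
    rw [contract_d_zero, contract_lie, contract_d_zero, contract_d_zero, lie_lie]
    abel
  | succ k ih =>
    refine ext_contract fun Y => ?_
    rw [contract_d_succ, contract_lie, contract_lie, contract_d_succ, contract_d_succ, map_sub, ih,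
      lie_sub, lie_lie]
    abel

/-- The factor `2` arises because each pair of arguments is bracketed twice, either one acting on
the other. For invariant `C` the left side is zero, so the two parts of `d` vanish together. -/
theorem alternatizeUncurryFin_lieDerivative {k : ℕ} (C : Cochain g (k + 1)) :
    alternatizeUncurryFin (lieDerivative C) = dAction (k + 1) C + (2 : ℂ) • dBracket k C := by
  change alternatizeUncurryFinLM (adComp C - alternatizeUncurryFinLM ∘ₗ bracketComp C) =
    alternatizeUncurryFinLM (adComp C) + (2 : ℂ) • -(1 / 2 : ℂ) •
      alternatizeUncurryFinLM (alternatizeUncurryFinLM ∘ₗ bracketComp C)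
  rw [map_sub]
  module

end CyclicLie

end

/-! ### Cyclic cochains under the action and contraction -/

noncomputable section

namespace CyclicLie

open AlternatingMap

variable {g : Type*} [LieRing g] [LieAlgebra ℂ g] {B : LinearMap.BilinForm ℂ g}

theorem hat_contract {k : ℕ} (X : g) (C : Cochain g (k + 1)) (Y : Fin (k + 1) → g) :
    hat B (contract X C) Y = hat B C (Fin.cons X Y : Fin (k + 2) → g) := by
  rw [hat, hat, contract_apply, ← Fin.succ_last, Fin.cons_succ]
  congr 3
  ext i
  refine Fin.cases ?_ (fun i => ?_) i <;> simp [Fin.init]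

theorem hat_neg {k : ℕ} (C : Cochain g k) (Y : Fin (k + 1) → g) :
    hat B (-C) Y = -hat B C Y := by
  simp [hat]

theorem hat_sub {k : ℕ} (C D : Cochain g k) (Y : Fin (k + 1) → g) :
    hat B (C - D) Y = hat B C Y - hat B D Y := by
  simp [hat]

/-- Invariance of `B` moves the bracket from the value to the last argument, so all arguments of
`hat` play the same role. -/
theorem hat_lie (hinv : B.lieInvariant g) {k : ℕ} (X : g) (C : Cochain g k)
    (Y : Fin (k + 1) → g) :
    hat B ⁅X, C⁆ Y = -∑ i, hat B C (Function.update Y i ⁅X, Y i⁆) := by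
  rw [hat, lie_cochain_apply, lieDer, map_sub, LinearMap.sub_apply, hinv, map_sum,
    LinearMap.sum_apply, Fin.sum_univ_castSucc]
  simp only [hat, Fin.init_update_castSucc, Fin.init_update_last, Function.update_self]
  have h : ∀ i : Fin k, Function.update Y i.castSucc ⁅X, Y i.castSucc⁆ (Fin.last k) =
      Y (Fin.last k) := fun i => Function.update_of_ne (Fin.castSucc_lt_last i).ne' _ _
  simp only [h, Fin.init]
  ring

theorem cons_last_init_eq {α : Type*} {k : ℕ} (Y : Fin (k + 1) → α) :
    (Fin.cons (Y (Fin.last k)) (Fin.init Y) : Fin (k + 1) → α) = Y ∘ (finRotate (k + 1)).symm := by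
  rw [← Equiv.comp_symm_eq]
  conv_rhs => rw [← Fin.snoc_init_self Y]
  rw [Fin.snoc_eq_cons_rotate]
  rfl

theorem lie_mem_cyclicCochains (hinv : B.lieInvariant g) {k : ℕ} (X : g) {C : Cochain g k}
    (hC : C ∈ cyclicCochains B k) : ⁅X, C⁆ ∈ cyclicCochains B k := by
  intro Y
  have hC' : ∀ Z : Fin (k + 1) → g, hat B C Z = (-1) ^ k * hat B C (Z ∘ (finRotate (k + 1)).symm) :=
    fun Z => by rw [← cons_last_init_eq]; exact hC Z
  rw [cons_last_init_eq, hat_lie hinv, hat_lie hinv, mul_neg, Finset.mul_sum]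
  congr 1
  -- The action treats all slots of `hat` alike, so rotating the arguments only permutes the
  -- summands.
  refine Fintype.sum_equiv (finRotate (k + 1)) _ _ fun i => ?_
  rw [hC', Function.update_comp_equiv, Equiv.symm_symm, Function.comp_apply,
    Equiv.symm_apply_apply]

theorem mem_cyclicCochains_zero (C : Cochain g 0) : C ∈ cyclicCochains B 0 := by
  intro Y
  rw [pow_zero, one_mul]
  congr 1
  ext i
  rw [Fin.fin_one_eq_zero i]
  rfl

theorem contract_mem_cyclicCochains {k : ℕ} (X : g) {C : Cochain g (k + 1)}
    (hC : C ∈ cyclicCochains B (k + 1)) : contract X C ∈ cyclicCochains B k := by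
  cases k with
  | zero => exact mem_cyclicCochains_zero _
  | succ k =>
    intro Y
    have h := hC (Fin.cons X Y)
    have h1 : Fin.init (Fin.cons X Y : Fin (k + 3) → g) = Fin.cons X (Fin.init Y) := by
      ext i
      refine Fin.cases ?_ (fun i => ?_) i <;> simp [Fin.init]
    -- Rotating `(X, Y)` puts the last entry of `Y` before `X`; exchanging the two costs the sign
    -- that turns `(-1) ^ (k + 2)` into `(-1) ^ (k + 1)`.
    rw [h1, ← Fin.succ_last, Fin.cons_succ, ← hat_contract, ← hat_contract, ← hat_contract,
      contract_contract, hat_neg, hat_contract X] at h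
    have h2 : hat B (contract X C) (Fin.cons (Y (Fin.last (k + 1))) (Fin.init Y)) =
        hat B (contract (Y (Fin.last (k + 1))) (contract X C)) (Fin.init Y) :=
      (hat_contract _ _ _).symm
    rw [hat_contract, h, h2]
    ring

/-- For cyclic cochains, the part of the differential involving the adjoint action is adjoint to
the action of `g` on cochains. -/
theorem dAction_eq_hat_lie (hinv : B.lieInvariant g) {k : ℕ} {C : Cochain g k}
    (hC : C ∈ cyclicCochains B k) (X : Fin (k + 1) → g) (Z : g) :
    B (dAction k C X) Z = (-1) ^ (k + 1) * hat B ⁅Z, C⁆ X := by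
  induction k with
  | zero =>
    have h : dAction 0 C X = ⁅X 0, C Fin.elim0⁆ := d_zero_apply C X
    have h2 : hat B ⁅Z, C⁆ X = B ⁅Z, C Fin.elim0⁆ (X 0) := by
      rw [hat, lie_cochain_apply, lieDer]
      simp [Subsingleton.elim (Fin.init X) Fin.elim0]
    rw [h, h2, hinv, hinv, ← lie_skew]
    simp only [map_neg]
    ring
  | succ k ih =>
    obtain ⟨W, Y, rfl⟩ : ∃ (W : g) (Y : Fin (k + 1) → g), X = Fin.cons W Y :=
      ⟨X 0, Fin.tail X, (Fin.cons_self_tail X).symm⟩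
    have h := congrArg (fun F => F Y) (contract_dAction W C)
    simp only [contract_apply, AlternatingMap.sub_apply, adComp_apply] at h
    rw [h, map_sub, LinearMap.sub_apply, ih (contract_mem_cyclicCochains W hC), hinv,
      ← hat_contract, contract_lie, hat_sub, hat_contract ⁅Z, W⁆]
    -- Cyclicity brings `⁅Z, W⁆` from the last slot to the first, where it cancels the correction
    -- term of `contract_lie`.
    have h3 := hC (Fin.snoc Y ⁅Z, W⁆)
    rw [Fin.snoc_last, Fin.init_snoc, hat, Fin.snoc_last, Fin.init_snoc] at h3
    rw [← lie_skew, map_neg, neg_neg, h3]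
    ring

theorem lie_eq_zero_of_mem_invariantCyclicCochains {k : ℕ} {C : Cochain g k}
    (hC : C ∈ invariantCyclicCochains B k) (X : g) : ⁅X, C⁆ = 0 := by
  ext Y
  rw [lie_cochain_apply, hC.2]
  rfl

/-- Invariant cyclic cochains are cocycles. -/
theorem d_eq_zero_of_mem_invariantCyclicCochains (hnondeg : B.Nondegenerate)
    (hinv : B.lieInvariant g) {k : ℕ} {C : Cochain g k}
    (hC : C ∈ invariantCyclicCochains B k) : d k C = 0 := by
  have h1 := lie_eq_zero_of_mem_invariantCyclicCochains hC
  have h2 : dAction k C = 0 := by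
    ext X
    rw [AlternatingMap.zero_apply]
    refine hnondeg.1 _ fun Z => ?_
    rw [dAction_eq_hat_lie hinv hC.1, h1]
    simp [hat]
  cases k with
  | zero => exact h2
  | succ k =>
    have h3 : lieDerivative C = 0 := LinearMap.ext h1
    have h4 := alternatizeUncurryFin_lieDerivative C
    rw [h3, h2, zero_add] at h4
    have h5 : dBracket k C = 0 := by
      refine (smul_eq_zero_iff_right (two_ne_zero (α := ℂ))).1 (h4.symm.trans ?_)
      exact map_zero (alternatizeUncurryFinLM (R := ℂ))
    change dAction _ _ + dBracket _ _ = 0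
    rw [h2, h5, add_zero]

end CyclicLie

end

noncomputable section

namespace CyclicLie

/-! ### Splitting off invariants -/

section Fitting

variable {K : Type*} [Field K] {L : Type*} [LieRing L]

/-- The subspace spanned by the `⁅x, v⁆` in a module over a Lie algebra. -/
def lieImage (K L V : Type*) [Field K] [LieRing L] [AddCommGroup V] [Module K V]
    [LieRingModule L V] : Submodule K V :=
  Submodule.span K {v | ∃ (x : L) (w : V), ⁅x, w⁆ = v}

/-- A module over a Lie algebra that is the direct sum of its invariants and of the subspace
spanned by the `⁅x, v⁆`. -/
structure SplitsInvariants (K L V : Type*) [Field K] [LieRing L] [AddCommGroup V] [Module K V]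
    [LieRingModule L V] : Prop where
  exists_sub_mem : ∀ v : V, ∃ u : V, (∀ x : L, ⁅x, u⁆ = 0) ∧ v - u ∈ lieImage K L V
  eq_zero_of_mem : ∀ v : V, (∀ x : L, ⁅x, v⁆ = 0) → v ∈ lieImage K L V → v = 0

variable {V : Type*} [AddCommGroup V] [Module K V] [LieRingModule L V]

theorem lie_mem_lieImage (x : L) (v : V) : ⁅x, v⁆ ∈ lieImage K L V :=
  Submodule.subset_span ⟨x, v, rfl⟩

variable (V) in
theorem splitsInvariants_of_trivial (h : ∀ (x : L) (v : V), ⁅x, v⁆ = 0) :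
    SplitsInvariants K L V where
  exists_sub_mem v := ⟨v, fun x => h x v, by simp⟩
  eq_zero_of_mem v _ hv := by
    have h1 : lieImage K L V ≤ ⊥ := by
      refine Submodule.span_le.2 ?_
      rintro _ ⟨x, w, rfl⟩
      exact h x w
    exact h1 hv

theorem lieImage_map_le (N : LieSubmodule K L V) :
    (lieImage K L N).map (N : Submodule K V).subtype ≤ lieImage K L V := by
  rw [lieImage, Submodule.map_span, Submodule.span_le]
  rintro _ ⟨_, ⟨x, w, rfl⟩, rfl⟩
  exact lie_mem_lieImage x (w : V)

/-- A Fitting type reduction: if `N` and `P` are complementary submodules such that all invariants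
belong to `N` and `P` is contained in the image of the action, then it suffices to treat `N`. -/
theorem SplitsInvariants.of_isCompl {N P : LieSubmodule K L V}
    (hNP : IsCompl (N : Submodule K V) (P : Submodule K V))
    (hN : ∀ v : V, (∀ x : L, ⁅x, v⁆ = 0) → v ∈ N)
    (hP : (P : Submodule K V) ≤ lieImage K L V) (h : SplitsInvariants K L N) :
    SplitsInvariants K L V where
  exists_sub_mem v := by
    obtain ⟨n, hn, p, hp, rfl⟩ := Submodule.mem_sup.1
      (hNP.sup_eq_top ▸ Submodule.mem_top : v ∈ (N : Submodule K V) ⊔ P)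
    obtain ⟨u, hu, hu'⟩ := h.exists_sub_mem ⟨n, hn⟩
    refine ⟨u, fun x => congrArg Subtype.val (hu x), ?_⟩
    have h1 := lieImage_map_le N (Submodule.mem_map_of_mem hu')
    have h2 := add_mem h1 (hP hp)
    convert h2 using 1
    simp
    abel
  eq_zero_of_mem v hv hv' := by
    -- Both summands are stable, so the image of the action splits along `N` and `P`; as `v` lies in
    -- `N`, its component in `P` must vanish.
    have h1 : lieImage K L V ≤ (lieImage K L N).map (N : Submodule K V).subtype ⊔ P := by
      refine Submodule.span_le.2 ?_
      rintro _ ⟨x, w, rfl⟩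
      obtain ⟨n, hn, p, hp, rfl⟩ := Submodule.mem_sup.1
        (hNP.sup_eq_top ▸ Submodule.mem_top : w ∈ (N : Submodule K V) ⊔ P)
      rw [lie_add]
      exact Submodule.add_mem_sup
        (Submodule.mem_map_of_mem (lie_mem_lieImage x (⟨n, hn⟩ : N))) (P.lie_mem hp)
    obtain ⟨_, ⟨⟨n, hnN⟩, hn, rfl⟩, p, hp, hap⟩ := Submodule.mem_sup.1 (h1 hv')
    have hvN : v ∈ N := hN v hv
    have hp0 : p = 0 := by
      refine (Submodule.disjoint_def.1 hNP.disjoint) p ?_ hp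
      have : p = v - n := by rw [← hap]; simp
      rw [this]
      exact sub_mem hvN hnN
    rw [hp0, add_zero] at hap
    have hn0 : (⟨n, hnN⟩ : N) = 0 := by
      refine h.eq_zero_of_mem _ (fun x => Subtype.ext ?_) hn
      exact (congrArg (fun w => ⁅x, w⁆) hap).trans (hv x)
    rw [← hap]
    exact congrArg Subtype.val hn0

end Fitting

/-! ### The Casimir operator of a trace form -/

section Casimir

open LieModule

variable {K : Type*} [Field K] {L : Type*} [LieRing L] [LieAlgebra K L]
variable {V : Type*} [AddCommGroup V] [Module K V] [LieRingModule L V] [LieModule K L V]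

/-- A Casimir operator: an ideal on which the trace form of `V` is nondegenerate yields an
endomorphism of `V` that commutes with the action, has its image in the image of the action, kills
all invariants, and whose trace is the dimension of the ideal. -/
theorem exists_casimir [FiniteDimensional K L] (I : LieIdeal K L)
    (hI : ∀ x ∈ I, (∀ y ∈ I, traceForm K L V x y = 0) → x = 0) :
    ∃ Ω : Module.End K V, (∀ (x : L) (v : V), Ω ⁅x, v⁆ = ⁅x, Ω v⁆) ∧
      (∀ v, Ω v ∈ lieImage K L V) ∧ (∀ v : V, (∀ x : L, ⁅x, v⁆ = 0) → Ω v = 0) ∧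
      LinearMap.trace K V Ω = Module.finrank K I := by
  classical
  let F : LinearMap.BilinForm K I := (traceForm K L V).restrict (I : Submodule K L)
  have hFapp : ∀ x y : I, F x y = traceForm K L V x y := fun _ _ => rfl
  have hFsymm : F.IsSymm := ⟨fun x y => traceForm_comm K L V x y⟩
  have hF : F.Nondegenerate := by
    rw [LinearMap.BilinForm.Nondegenerate, hFsymm.isRefl.nondegenerate_iff_separatingLeft]
    intro x hx
    exact Subtype.ext (hI x x.2 fun y hy => hx ⟨y, hy⟩)
  let b := Module.finBasis K I
  let b' := F.dualBasis hF b
  have hb : ∀ x : I, x = ∑ i, F x (b' i) • b i := fun x => by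
    conv_lhs => rw [← b.sum_repr x]
    have h : ∀ i, F (∑ j, b.repr x j • b j) (b' i) = b.repr x i := fun i => by
      simp only [map_sum, map_smul, LinearMap.sum_apply, LinearMap.smul_apply, smul_eq_mul, b',
        LinearMap.BilinForm.apply_dualBasis_right hF hFsymm, mul_ite, mul_one, mul_zero,
        Finset.sum_ite_eq', Finset.mem_univ, if_true]
    rw [b.sum_repr] at h
    exact Finset.sum_congr rfl fun i _ => by rw [h]
  have hb' : ∀ x : I, x = ∑ i, F x (b i) • b' i := fun x => by
    conv_lhs => rw [← b'.sum_repr x]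
    refine Finset.sum_congr rfl fun i _ => ?_
    rw [LinearMap.BilinForm.dualBasis_repr_apply]
  let φ : L →ₗ[K] Module.End K V := (toEnd K L V : L →ₗ[K] Module.End K V)
  have happ : ∀ v, (∑ i, φ (b i) * φ (b' i)) v = ∑ i, ⁅(b i : L), ⁅(b' i : L), v⁆⁆ := fun v => by
    simp [LinearMap.sum_apply, φ]
  refine ⟨∑ i, φ (b i) * φ (b' i), fun x v => ?_, fun v => ?_, fun v hv => ?_, ?_⟩
  · rw [happ, happ, lie_sum, ← sub_eq_zero, ← Finset.sum_sub_distrib]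
    have h1 : ∀ i, ⁅x, (b i : L)⁆ = ∑ j, traceForm K L V ⁅x, (b i : L)⁆ (b' j) • (b j : L) := by
      intro i
      have := congrArg (Subtype.val) (hb ⟨⁅x, (b i : L)⁆, I.lie_mem (b i).2⟩)
      simpa [hFapp] using this
    have h2 : ∀ i, ⁅x, (b' i : L)⁆ = ∑ j, traceForm K L V ⁅x, (b' i : L)⁆ (b j) • (b' j : L) := by
      intro i
      have := congrArg (Subtype.val) (hb' ⟨⁅x, (b' i : L)⁆, I.lie_mem (b' i).2⟩)
      simpa [hFapp] using this
    have h3 : ∀ i, ⁅(b i : L), ⁅(b' i : L), ⁅x, v⁆⁆⁆ - ⁅x, ⁅(b i : L), ⁅(b' i : L), v⁆⁆⁆ =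
        -(⁅⁅x, (b i : L)⁆, ⁅(b' i : L), v⁆⁆ + ⁅(b i : L), ⁅⁅x, (b' i : L)⁆, v⁆⁆) := by
      intro i
      rw [lie_lie, lie_lie x (b' i : L), lie_sub]
      abel
    -- By invariance of the trace form, `ad x` has opposite transposed matrices in the dual bases,
    -- so the two sums in the commutator with `x` cancel.
    have h4 : ∀ i j, traceForm K L V ⁅x, (b' i : L)⁆ (b j) =
        -traceForm K L V ⁅x, (b j : L)⁆ (b' i) := by
      intro i j
      rw [← lie_skew, map_neg, LinearMap.neg_apply, traceForm_apply_lie_apply, traceForm_comm]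
    have h5 : ∀ i, ⁅⁅x, (b i : L)⁆, ⁅(b' i : L), v⁆⁆ =
        ∑ j, traceForm K L V ⁅x, (b i : L)⁆ (b' j) • ⁅(b j : L), ⁅(b' i : L), v⁆⁆ := by
      intro i
      conv_lhs => rw [h1 i, sum_lie]
      exact Finset.sum_congr rfl fun j _ => smul_lie _ _ _
    have h6 : ∀ i, ⁅(b i : L), ⁅⁅x, (b' i : L)⁆, v⁆⁆ =
        -∑ j, traceForm K L V ⁅x, (b j : L)⁆ (b' i) • ⁅(b i : L), ⁅(b' j : L), v⁆⁆ := by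
      intro i
      conv_lhs => rw [h2 i, sum_lie, lie_sum]
      rw [← Finset.sum_neg_distrib]
      exact Finset.sum_congr rfl fun j _ => by rw [h4, smul_lie, lie_smul, neg_smul]
    simp only [h3]
    rw [Finset.sum_neg_distrib, neg_eq_zero, Finset.sum_add_distrib,
      Finset.sum_congr rfl fun i _ => h5 i, Finset.sum_congr rfl fun i _ => h6 i,
      Finset.sum_neg_distrib, Finset.sum_comm, add_neg_cancel]
  · rw [happ]
    exact Submodule.sum_mem _ fun i _ => lie_mem_lieImage _ _
  · rw [happ]
    simp [hv]
  -- Each summand has trace `F (b i) (b' i) = 1`.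
  · have h5 : ∀ i, LinearMap.trace K V (φ (b i) * φ (b' i)) = 1 := by
      intro i
      have := LinearMap.BilinForm.apply_dualBasis_right hF hFsymm b i i
      rw [if_pos rfl, hFapp, traceForm_apply_apply] at this
      exact this
    simp [map_sum, h5]

end Casimir

/-! ### Complete reducibility in the semisimple and reductive cases -/

section Semisimple

open LieModule LieAlgebra

variable {K : Type*} [Field K] {L : Type*} [LieRing L] [LieAlgebra K L]

attribute [local instance] LieRing.ofAssociativeRing in
theorem isNilpotent_toEnd_ad {V : Type*} [AddCommGroup V] [Module K V] [LieRingModule L V]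
    [LieModule K L V] {x : L} (hx : IsNilpotent (toEnd K L V x)) :
    ∃ n : ℕ, ∀ y : L, (ad K L x ^ n) y ∈ LieModule.ker K L V := by
  obtain ⟨n, hn⟩ := LieAlgebra.ad_nilpotent_of_nilpotent (R := K) hx
  have h1 : ∀ (m : ℕ) (y : L), toEnd K L V ((ad K L x ^ m) y) =
      (ad K (Module.End K V) (toEnd K L V x) ^ m) (toEnd K L V y) := by
    intro m
    induction m with
    | zero => intro y; rfl
    | succ m ih =>
      intro y
      rw [pow_succ, pow_succ, Module.End.mul_apply, Module.End.mul_apply, ih]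
      simp
  refine ⟨n, fun y => ?_⟩
  rw [LieModule.mem_ker]
  intro v
  have := h1 n y
  rw [hn] at this
  exact congrArg (fun T : Module.End K V => T v) this

variable [FiniteDimensional K L]

/-- The preimage of a solvable ideal has its derived series in the center after finitely many steps,
and zero one step later. It is thus solvable, hence contained in the radical, which is the center.
-/
theorem hasTrivialRadical_quotient_center [HasCentralRadical K L] :
    HasTrivialRadical K (L ⧸ center K L) := by
  let π : L →ₗ⁅K⁆ L ⧸ center K L :=
    { (LieSubmodule.Quotient.mk' (center K L) : L →ₗ[K] L ⧸ center K L) with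
      map_lie' := rfl }
  refine hasTrivialRadical_of_no_solvable_ideals (R := K) fun J hJ => ?_
  obtain ⟨n, hn⟩ := IsSolvable.solvable K J
  rw [LieIdeal.derivedSeries_eq_bot_iff] at hn
  have h1 : ∀ m, derivedSeriesOfIdeal K L m (J.comap π) ≤
      (derivedSeriesOfIdeal K (L ⧸ center K L) m J).comap π := by
    intro m
    induction m with
    | zero => exact le_rfl
    | succ m ih =>
      rw [derivedSeriesOfIdeal_succ, derivedSeriesOfIdeal_succ]
      exact (LieSubmodule.mono_lie ih ih).trans (LieIdeal.comap_bracket_le π)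
  have h2 : derivedSeriesOfIdeal K L n (J.comap π) ≤ center K L := by
    refine (h1 n).trans fun x hx => ?_
    rw [hn, LieIdeal.mem_comap, LieSubmodule.mem_bot] at hx
    exact (LieSubmodule.Quotient.mk_eq_zero (N := center K L)).1 hx
  have h3 : IsSolvable (J.comap π) := by
    refine IsSolvable.mk (R := K) (k := n + 1) ?_
    rw [LieIdeal.derivedSeries_eq_bot_iff, derivedSeriesOfIdeal_succ, eq_bot_iff]
    refine (LieSubmodule.mono_lie h2 h2).trans ?_
    rw [LieSubmodule.lie_le_iff]
    intro x _ y hy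
    exact (LieModule.mem_maxTrivSubmodule K L L y).1 hy x
  have h4 : J.comap π ≤ center K L :=
    ((LieIdeal.solvable_iff_le_radical K L _).1 h3).trans
      (HasCentralRadical.radical_eq_center (R := K) (L := L)).le
  rw [LieSubmodule.eq_bot_iff]
  intro q hq
  obtain ⟨x, rfl⟩ := LieSubmodule.Quotient.surjective_mk' (center K L) q
  exact (LieSubmodule.Quotient.mk_eq_zero (N := center K L)).2 (h4 hq)

variable [CharZero K]

/-- Take an ideal complement `I` of the kernel of the representation and let `J` be the radical of
the trace form on `I`. Cartan's criterion makes `D = ⁅J, J⁆` act nilpotently on `V`; Engel's theorem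
then makes `D` nilpotent, hence zero, so `J` is an abelian ideal and vanishes. -/
theorem exists_ideal_traceForm_nondegenerate [HasTrivialRadical K L] {V : Type*} [AddCommGroup V]
    [Module K V] [LieRingModule L V] [LieModule K L V] [FiniteDimensional K V] :
    ∃ I : LieIdeal K L, IsCompl (LieModule.ker K L V) I ∧
      ∀ x ∈ I, (∀ y ∈ I, traceForm K L V x y = 0) → x = 0 := by
  obtain ⟨I, hI⟩ := exists_isCompl (LieModule.ker K L V)
  refine ⟨I, hI, ?_⟩
  let J : LieIdeal K L :=
    InvariantForm.orthogonal (traceForm K L V) (traceForm_lieInvariant K L V) I ⊓ I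
  have hJI : J ≤ I := inf_le_right
  suffices h : J = ⊥ by
    intro x hx hxy
    have : x ∈ J := by
      refine ⟨?_, hx⟩
      refine (InvariantForm.mem_orthogonal _ _ _ _).2 fun y hy => ?_
      rw [traceForm_comm]
      exact hxy y hy
    rw [h] at this
    simpa using this
  have hJ0 : ∀ x ∈ J, ∀ y ∈ J, traceForm K L V x y = 0 := fun x hx y hy =>
    (InvariantForm.mem_orthogonal _ _ _ _).1 hy.1 x hx.2
  have hnil : LieModule.IsNilpotent (derivedSeries K J 1) V :=
    LieModule.isNilpotent_derivedSeries_of_traceForm_eq_zero (R := K) (L := J) (M := V) <| by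
      ext x y
      exact hJ0 x x.2 y y.2
  let D : LieIdeal K L := ⁅J, J⁆
  have hDJ : D ≤ J := LieSubmodule.lie_le_left J J
  have hD : ∀ x ∈ D, IsNilpotent (toEnd K L V x) := by
    intro x hx
    refine (LieModule.isNilpotent_iff_forall' (R := K)).1 hnil ⟨⟨x, hDJ hx⟩, ?_⟩
    rw [LieIdeal.derivedSeries_eq_derivedSeriesOfIdeal_comap, LieIdeal.mem_comap]
    exact hx
  have hDad : ∀ x ∈ D, IsNilpotent (ad K L x) := by
    intro x hx
    obtain ⟨n, hn⟩ := isNilpotent_toEnd_ad (hD x hx)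
    refine ⟨n + 1, ?_⟩
    ext y
    have h2 := hn y
    rw [pow_succ', Module.End.mul_apply, ad_apply, LinearMap.zero_apply]
    -- A power of `ad x` lands in the kernel; one more bracket with `x ∈ I` lands in the kernel and
    -- in `I`, which meet trivially.
    have h3 : ⁅x, (ad K L x ^ n) y⁆ ∈ LieModule.ker K L V ⊓ I :=
      ⟨(LieModule.ker K L V).lie_mem h2, lie_mem_left K L I _ _ (hJI (hDJ hx))⟩
    rw [hI.inf_eq_bot] at h3
    simpa using h3
  have hDnil : LieRing.IsNilpotent D := by
    rw [LieAlgebra.isNilpotent_iff_forall (R := K)]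
    rintro ⟨x, hx⟩
    exact LieSubalgebra.isNilpotent_ad_of_isNilpotent_ad (D : LieSubalgebra K L) (x := ⟨x, hx⟩)
      (hDad x hx)
  have hDsolv : LieAlgebra.IsSolvable D := inferInstance
  have hD0 : D = ⊥ := HasTrivialRadical.eq_bot_of_isSolvable (R := K) D
  have hJab : IsLieAbelian J := by
    refine ⟨fun x y => Subtype.ext ?_⟩
    have : ⁅(x : L), (y : L)⁆ ∈ D := LieSubmodule.lie_mem_lie x.2 y.2
    rw [hD0] at this
    simpa using this
  exact (hasTrivialRadical_iff_no_abelian_ideals K L).1 inferInstance J hJab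

/-- A form of Weyl's theorem on complete reducibility. -/
theorem splitsInvariants_of_hasTrivialRadical [HasTrivialRadical K L] (n : ℕ) :
    ∀ (V : Type*) [AddCommGroup V] [Module K V] [LieRingModule L V] [LieModule K L V]
      [FiniteDimensional K V], Module.finrank K V = n → SplitsInvariants K L V := by
  induction n using Nat.strong_induction_on with
  | _ n ih =>
  intro V _ _ _ _ _ hV
  obtain ⟨I, hI, hnd⟩ := exists_ideal_traceForm_nondegenerate (K := K) (L := L) (V := V)
  by_cases hI0 : I = ⊥
  · refine splitsInvariants_of_trivial V fun x => ?_
    have : LieModule.ker K L V = ⊤ := by simpa [hI0] using hI.sup_eq_top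
    exact (LieModule.mem_ker K L V x).1 (this ▸ LieSubmodule.mem_top x)
  obtain ⟨Ω, hcomm, him, hinv, htr⟩ := exists_casimir I hnd
  have hpow : ∀ (m : ℕ) (x : L) (v : V), (Ω ^ m) ⁅x, v⁆ = ⁅x, (Ω ^ m) v⁆ := by
    intro m
    induction m with
    | zero => intro x v; rfl
    | succ m ihm => intro x v; rw [pow_succ', Module.End.mul_apply, ihm, hcomm]; rfl
  -- A large power gives the Fitting decomposition; the exponent must be positive for the power to
  -- kill the invariants and have its range in that of `Ω`.
  obtain ⟨m, hm, hm0⟩ := (Ω.eventually_isCompl_ker_pow_range_pow.and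
    (Filter.eventually_gt_atTop 0)).exists
  obtain ⟨m, rfl⟩ := Nat.exists_eq_succ_of_ne_zero hm0.ne'
  let N : LieSubmodule K L V :=
    { (Ω ^ (m + 1)).ker with
      lie_mem := fun {x v} hv => by
        change (Ω ^ (m + 1)) ⁅x, v⁆ = 0
        rw [hpow, show (Ω ^ (m + 1)) v = 0 from hv, lie_zero] }
  let P : LieSubmodule K L V :=
    { (Ω ^ (m + 1)).range with
      lie_mem := by
        rintro x _ ⟨v, rfl⟩
        exact ⟨⁅x, v⁆, hpow _ _ _⟩ }
  refine SplitsInvariants.of_isCompl (N := N) (P := P) hm ?_ ?_ (ih _ ?_ N rfl)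
  · intro v hv
    change (Ω ^ (m + 1)) v = 0
    rw [pow_succ, Module.End.mul_apply, hinv v hv, map_zero]
  · rintro _ ⟨v, rfl⟩
    rw [pow_succ', Module.End.mul_apply]
    exact him _
  · rw [← hV]
    -- If the kernel were all of `V`, `Ω` would be nilpotent of trace zero; but its trace is the
    -- dimension of `I ≠ ⊥`, nonzero in characteristic zero.
    refine Submodule.finrank_lt fun htop => ?_
    have hker : (Ω ^ (m + 1)).ker = ⊤ := htop
    have hnil : IsNilpotent Ω := ⟨m + 1, LinearMap.ker_eq_top.1 hker⟩
    have h0 := (LinearMap.isNilpotent_trace_of_isNilpotent hnil).eq_zero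
    rw [htr, Nat.cast_eq_zero] at h0
    refine hI0 ?_
    have h1 : (I : Submodule K L) = ⊥ := Submodule.finrank_eq_zero.1 h0
    simpa using h1

/-- The quotient by the center acts on any module on which the center acts trivially. -/
@[reducible]
def quotientLieRingModule {V : Type*} [AddCommGroup V]
    [Module K V] [LieRingModule L V] [LieModule K L V]
    (hV : ∀ x ∈ center K L, ∀ v : V, ⁅x, v⁆ = 0) : LieRingModule (L ⧸ center K L) V :=
  let φ : (L ⧸ center K L) →ₗ[K] Module.End K V :=
    (center K L : Submodule K L).liftQ (toEnd K L V : L →ₗ[K] Module.End K V)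
      fun x hx => LinearMap.ext fun v => hV x hx v
  { bracket := fun q v => φ q v
    add_lie := fun p q v => by
      change φ (p + q) v = φ p v + φ q v
      rw [map_add]; rfl
    lie_add := fun q v w => map_add (φ q) v w
    leibniz_lie := fun p q v => by
      induction p using Submodule.Quotient.induction_on with | _ x
      induction q using Submodule.Quotient.induction_on with | _ y
      exact leibniz_lie x y v }

/-- Modules over a reductive Lie algebra on which the center acts trivially are the direct sum
of their invariants and of the image of the action. -/
theorem splitsInvariants_of_hasCentralRadical [HasCentralRadical K L] (V : Type*) [AddCommGroup V]
    [Module K V] [LieRingModule L V] [LieModule K L V] [FiniteDimensional K V]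
    (hV : ∀ x ∈ center K L, ∀ v : V, ⁅x, v⁆ = 0) : SplitsInvariants K L V := by
  let _ := quotientLieRingModule (K := K) hV
  have hbr : ∀ (x : L) (v : V), ⁅(LieSubmodule.Quotient.mk x : L ⧸ center K L), v⁆ = ⁅x, v⁆ :=
    fun _ _ => rfl
  have _ : LieModule K (L ⧸ center K L) V :=
    { smul_lie := fun c q v => by
        induction q using Submodule.Quotient.induction_on with | _ x
        exact smul_lie c x v
      lie_smul := fun c q v => by
        induction q using Submodule.Quotient.induction_on with | _ x
        exact lie_smul c x v }
  have _ := hasTrivialRadical_quotient_center (K := K) (L := L)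
  have h := splitsInvariants_of_hasTrivialRadical (K := K) (L := L ⧸ center K L) _ V rfl
  have him : lieImage K (L ⧸ center K L) V = lieImage K L V := by
    refine congrArg (Submodule.span K) (Set.ext fun v => ⟨?_, ?_⟩)
    · rintro ⟨q, w, rfl⟩
      induction q using Submodule.Quotient.induction_on with | _ x
      exact ⟨x, w, rfl⟩
    · rintro ⟨x, w, rfl⟩
      exact ⟨LieSubmodule.Quotient.mk x, w, rfl⟩
  refine ⟨fun v => ?_, fun v hv hv' => ?_⟩
  · obtain ⟨u, hu, hu'⟩ := h.exists_sub_mem v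
    exact ⟨u, fun x => hu (LieSubmodule.Quotient.mk x), him ▸ hu'⟩
  · refine h.eq_zero_of_mem v (fun q => ?_) (him ▸ hv')
    induction q using Submodule.Quotient.induction_on with | _ x
    exact hv x

end Semisimple

end CyclicLie

end

/-! ### Invariant representatives of cyclic classes -/

noncomputable section

namespace CyclicLie

variable {g : Type*} [LieRing g] [LieAlgebra ℂ g] {B : LinearMap.BilinForm ℂ g}

instance [FiniteDimensional ℂ g] (k : ℕ) : FiniteDimensional ℂ (Cochain g k) :=
  Module.Finite.of_injective
    (AlternatingMap.toMultilinearMapLM : Cochain g k →ₗ[ℂ] MultilinearMap ℂ (fun _ : Fin k => g) g)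
    AlternatingMap.coe_multilinearMap_injective

theorem lie_cochain_eq_zero_of_mem_center {k : ℕ} {X : g} (hX : X ∈ LieAlgebra.center ℂ g)
    (C : Cochain g k) : ⁅X, C⁆ = 0 := by
  have h : ∀ Y : g, ⁅X, Y⁆ = 0 := fun Y => by
    rw [← lie_skew, (LieModule.mem_maxTrivSubmodule ℂ g g X).1 hX Y, neg_zero]
  ext Y
  rw [lie_cochain_apply, lieDer, h, zero_sub, AlternatingMap.zero_apply, neg_eq_zero]
  refine Finset.sum_eq_zero fun i _ => ?_
  rw [h, AlternatingMap.map_update_zero]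

theorem splitsInvariants_of_le_cochain [FiniteDimensional ℂ g] [LieAlgebra.HasCentralRadical ℂ g]
    {k : ℕ} (N : LieSubmodule ℂ g (Cochain g k)) : SplitsInvariants ℂ g N :=
  splitsInvariants_of_hasCentralRadical N fun _ hX C =>
    Subtype.ext (lie_cochain_eq_zero_of_mem_center hX (C : Cochain g k))

/-- The cyclic cochains as a `g`-submodule. -/
def cyclicLieSubmodule (hinv : B.lieInvariant g) (k : ℕ) : LieSubmodule ℂ g (Cochain g k) :=
  { cyclicCochains B k with lie_mem := fun hC => lie_mem_cyclicCochains hinv _ hC }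

/-- The cyclic cocycles as a `g`-submodule. -/
def cocycleLieSubmodule (hinv : B.lieInvariant g) (k : ℕ) : LieSubmodule ℂ g (Cochain g k) :=
  { cyclicCocycles B k with
    lie_mem := fun {X C} hC => by
      refine ⟨lie_mem_cyclicCochains hinv X hC.1, ?_⟩
      change d k ⁅X, C⁆ = 0
      rw [d_lie, show d k C = 0 from hC.2, lie_zero] }

theorem mem_invariantCyclicCochains {k : ℕ} {C : Cochain g k} (hC : C ∈ cyclicCochains B k)
    (h : ∀ X : g, ⁅X, C⁆ = 0) : C ∈ invariantCyclicCochains B k :=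
  ⟨hC, fun X Y => by rw [← lie_cochain_apply, h]; rfl⟩

/-- The action of `g` maps cyclic cocycles to cyclic coboundaries. -/
theorem lie_mem_cyclicCoboundaries {k : ℕ} {C : Cochain g k} (hC : C ∈ cyclicCocycles B k)
    (X : g) : ⁅X, C⁆ ∈ cyclicCoboundaries B k := by
  have hd : d k C = 0 := hC.2
  cases k with
  | zero =>
    have h := contract_d_zero X C
    rw [hd, map_zero] at h
    rw [← h]
    exact zero_mem _
  | succ k =>
    have h := contract_d_succ X C
    rw [hd, map_zero] at h
    rw [sub_eq_zero.1 h.symm]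
    exact Submodule.mem_map_of_mem (contract_mem_cyclicCochains X hC.1)

section Reductive

variable [FiniteDimensional ℂ g] [LieAlgebra.HasCentralRadical ℂ g]

/-- Split the module of cyclic cocycles: its part in the image of the action consists of
coboundaries, by Cartan's formula. -/
theorem exists_invariant_sub_mem_cyclicCoboundaries (hinv : B.lieInvariant g) {k : ℕ}
    {C : Cochain g k} (hC : C ∈ cyclicCocycles B k) :
    ∃ D ∈ invariantCyclicCochains B k, C - D ∈ cyclicCoboundaries B k := by
  obtain ⟨u, hu, hu'⟩ :=
    (splitsInvariants_of_le_cochain (cocycleLieSubmodule hinv k)).exists_sub_mem ⟨C, hC⟩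
  refine ⟨u, mem_invariantCyclicCochains u.2.1 fun X => congrArg Subtype.val (hu X), ?_⟩
  have h : lieImage ℂ g (cocycleLieSubmodule hinv k) ≤ (cyclicCoboundaries B k).comap
      (cocycleLieSubmodule hinv k : Submodule ℂ (Cochain g k)).subtype := by
    refine Submodule.span_le.2 ?_
    rintro _ ⟨X, w, rfl⟩
    exact lie_mem_cyclicCoboundaries w.2 X
  exact h hu'

/-- The splitting is used twice: on cyclic cochains, to remove the closed invariant part of a
primitive, and on all cochains, where invariants meet the image of the action only in zero. -/
theorem eq_zero_of_mem_cyclicCoboundaries (hnondeg : B.Nondegenerate) (hinv : B.lieInvariant g)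
    {k : ℕ} {C : Cochain g k} (hC : C ∈ invariantCyclicCochains B k)
    (hC' : C ∈ cyclicCoboundaries B k) : C = 0 := by
  cases k with
  | zero => exact hC'
  | succ k =>
    obtain ⟨D, hD, rfl⟩ := hC'
    obtain ⟨u, hu, hu'⟩ :=
      (splitsInvariants_of_le_cochain (cyclicLieSubmodule hinv k)).exists_sub_mem ⟨D, hD⟩
    have hdu : d k (u : Cochain g k) = 0 := d_eq_zero_of_mem_invariantCyclicCochains hnondeg hinv
      (mem_invariantCyclicCochains u.2 fun X => congrArg Subtype.val (hu X))
    have h : lieImage ℂ g (cyclicLieSubmodule hinv k) ≤ (lieImage ℂ g (Cochain g (k + 1))).comap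
        (d k ∘ₗ (cyclicLieSubmodule hinv k : Submodule ℂ (Cochain g k)).subtype) := by
      refine Submodule.span_le.2 ?_
      rintro _ ⟨X, w, rfl⟩
      have hw : d k ⁅X, (w : Cochain g k)⁆ ∈ lieImage ℂ g (Cochain g (k + 1)) := by
        rw [d_lie]
        exact lie_mem_lieImage X _
      exact hw
    have h1 : d k (D - (u : Cochain g k)) ∈ lieImage ℂ g (Cochain g (k + 1)) := h hu'
    rw [map_sub, hdu, sub_zero] at h1
    exact (splitsInvariants_of_hasCentralRadical (K := ℂ) (Cochain g (k + 1)) fun _ hX C =>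
      lie_cochain_eq_zero_of_mem_center hX C).eq_zero_of_mem _
      (lie_eq_zero_of_mem_invariantCyclicCochains hC) h1

end Reductive

theorem invariantCyclicCochains_le_cyclicCocycles (hnondeg : B.Nondegenerate)
    (hinv : B.lieInvariant g) (k : ℕ) : invariantCyclicCochains B k ≤ cyclicCocycles B k :=
  fun _ hC => ⟨hC.1, d_eq_zero_of_mem_invariantCyclicCochains hnondeg hinv hC⟩

theorem cyclicClass_eq_iff {k : ℕ} (Z W : cyclicCocycles B k) :
    cyclicClass B k Z = cyclicClass B k W ↔
      (Z : Cochain g k) - (W : Cochain g k) ∈ cyclicCoboundaries B k :=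
  Submodule.Quotient.eq _

/-- The class of an invariant cyclic cochain. -/
def invariantClass (hnondeg : B.Nondegenerate) (hinv : B.lieInvariant g) (k : ℕ) :
    invariantCyclicCochains B k →ₗ[ℂ] CyclicCohomology B k :=
  cyclicClass B k ∘ₗ
    Submodule.inclusion (invariantCyclicCochains_le_cyclicCocycles hnondeg hinv k)

theorem bijective_invariantClass [FiniteDimensional ℂ g] [LieAlgebra.HasCentralRadical ℂ g]
    (hnondeg : B.Nondegenerate) (hinv : B.lieInvariant g) (k : ℕ) :
    Function.Bijective (invariantClass hnondeg hinv k) := by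
  refine ⟨fun C D h => ?_, fun c => ?_⟩
  · have h1 := (cyclicClass_eq_iff _ _).1 h
    exact Subtype.ext (sub_eq_zero.1
      (eq_zero_of_mem_cyclicCoboundaries hnondeg hinv (sub_mem C.2 D.2) h1))
  · obtain ⟨Z, rfl⟩ := Submodule.mkQ_surjective _ c
    obtain ⟨D, hD, hZD⟩ := exists_invariant_sub_mem_cyclicCoboundaries hinv Z.2
    exact ⟨⟨D, hD⟩, ((cyclicClass_eq_iff Z _).2 hZD).symm⟩

end CyclicLie

end

theorem proposition6p1p5 {g : Type*} [LieRing g] [LieAlgebra ℂ g] [FiniteDimensional ℂ g]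
    (B : LinearMap.BilinForm ℂ g) (hsymm : B.IsSymm) (hnondeg : B.Nondegenerate)
    (hinv : B.lieInvariant g) :
    (∀ (k : ℕ), ∀ C ∈ CyclicLie.invariantCyclicCochains B k, CyclicLie.d k C = 0) ∧
    (LieAlgebra.HasCentralRadical ℂ g →
      (∀ (k : ℕ) (c : CyclicLie.CyclicCohomology B k),
        ∃! Z : CyclicLie.cyclicCocycles B k,
          (Z : CyclicLie.Cochain g k) ∈ CyclicLie.invariantCyclicCochains B k ∧
            CyclicLie.cyclicClass B k Z = c) ∧
      (∀ (k : ℕ), ∀ C ∈ CyclicLie.invariantCyclicCochains B k,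
        C ∈ CyclicLie.cyclicCoboundaries B k → C = 0) ∧
      ∃ e : (⨁ k : ℕ, CyclicLie.invariantCyclicCochains B k) ≃ₗ[ℂ]
          (⨁ k : ℕ, CyclicLie.CyclicCohomology B k),
        ∀ (k : ℕ) (C : CyclicLie.invariantCyclicCochains B k)
          (hC : (C : CyclicLie.Cochain g k) ∈ CyclicLie.cyclicCocycles B k),
          e (DirectSum.lof ℂ ℕ (fun k => CyclicLie.invariantCyclicCochains B k) k C) =
            DirectSum.lof ℂ ℕ (fun k => CyclicLie.CyclicCohomology B k) k
              (CyclicLie.cyclicClass B k ⟨C, hC⟩)) := by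
  refine ⟨fun k C hC => CyclicLie.d_eq_zero_of_mem_invariantCyclicCochains hnondeg hinv hC,
    fun _ => ⟨fun k c => ?_,
      fun k C hC hC' => CyclicLie.eq_zero_of_mem_cyclicCoboundaries hnondeg hinv hC hC',
      DFinsupp.mapRange.linearEquiv fun k => LinearEquiv.ofBijective _
        (CyclicLie.bijective_invariantClass hnondeg hinv k), fun k C hC => ?_⟩⟩
  · obtain ⟨C, rfl⟩ := (CyclicLie.bijective_invariantClass hnondeg hinv k).2 c
    refine ⟨Submodule.inclusion
      (CyclicLie.invariantCyclicCochains_le_cyclicCocycles hnondeg hinv k) C, ⟨C.2, rfl⟩, ?_⟩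
    rintro W ⟨hW, hWC⟩
    have h : (⟨W, hW⟩ : CyclicLie.invariantCyclicCochains B k) = C :=
      (CyclicLie.bijective_invariantClass hnondeg hinv k).1 hWC
    have h' : (W : CyclicLie.Cochain g k) = C := congrArg Subtype.val h
    exact Subtype.ext h'
  · exact DFinsupp.mapRange_single (hf := fun k => map_zero _)
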